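/- Let $n$ be a natural number, let $E_1,\dots,E_n$ and $F$ be Banach spaces over $\mathbb K$ ($\mathbb K=\mathbb R$ or $\mathbb C$). Let $\mathcal B^n(E_1,\dots,E_n;F)$ be the space of bounded $n$-linear maps $E_1\times\cdots\times E_n\to F$ with the norm $\|T\|=\inf\{C\ge 0:\|T(x_1,\dots,x_n)\|\le C\|x_1\|\cdots\|x_n\|\text{ for all }x_i\in E_i\}$. An $n$-linear map $T:E_1\times\cdots\times E_n\to F$ is called compact (respectively weakly compact) if the closure of $\{T(x_1,\dots,x_n): x_i\in E_i,\ \|x_i\|<1\}$ in the norm topology (respectively the weak topology) of $F$ is compact in that topology; write $\mathcal K^n(E_1,\dots,E_n;F)$ (respectively $w\mathcal K^n(E_1,\dots,E_n;F)$) for the set of all such maps. For a Banach space $G$, let $\mathcal K(G,F)$ (respectively $w\mathcal K(G,F)$) be the set of all linear maps $S:G\to F$ such that the norm (respectively weak) closure of $\{S(z):z\in G,\ \|z\|<1\}$ is norm (respectively weakly) compact. Let $\widehat\bigotimes_{i=1}^n E_i$ be the completed projective tensor product, that is, the completion of the algebraic tensor product in the norm $\|z\|=\inf\{\sum_j\|x_{j,1}\|\cdots\|x_{j,n}\|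 : z=\sum_j x_{j,1}\otimes\cdots\otimes x_{j,n}\}$ (finite sums). Then $\mathcal K^n(E_1,\dots,E_n;F)$ and $w\mathcal K^n(E_1,\dots,E_n;F)$ are norm-closed linear subspaces of $\mathcal B^n(E_1,\dots,E_n;F)$ (in particular all their elements are bounded). Likewise $\mathcal K(\widehat\bigotimes_{i=1}^n E_i,F)$ and $w\mathcal K(\widehat\bigotimes_{i=1}^n E_i,F)$ are linear subspaces of $\mathcal B(\widehat\bigotimes_{i=1}^n E_i,F)$, the space of bounded linear maps with the operator norm. With the inherited norms, $\mathcal K^n(E_1,\dots,E_n;F)$ is isometrically isomorphic to $\mathcal K(\widehat\bigotimes_{i=1}^n E_i,F)$, and $w\mathcal K^n(E_1,\dots,E_n;F)$ is isometrically isomorphic to $w\mathcal K(\widehat\bigotimes_{i=1}^n E_i,F)$; in both cases a linear isometric isomorphism is $T\mapsto\widetilde T$, where $\widetilde T$ satisfies $\widetilde T(x_1\otimes\cdots\otimes x_n)=T(x_1,\dots,x_n)$ for all $x_i\in E_i$. -/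

import Mathlib

open scoped TensorProduct

/-- An `n`-linear map `T : E₁ × ⋯ × Eₙ → F` is compact with respect to a topology `𝒯` on `F` if the
`𝒯`-closure of the image of the product of the open unit balls is `𝒯`-compact.
No continuity of `T` is presupposed. -/
def MultilinearMap.IsCompactWrt {𝕜 : Type*} [NormedField 𝕜] {n : ℕ} {E : Fin n → Type*}
    [∀ i, NormedAddCommGroup (E i)] [∀ i, NormedSpace 𝕜 (E i)]
    {F : Type*} [AddCommGroup F] [Module 𝕜 F]
    (𝒯 : TopologicalSpace F) (T : MultilinearMap 𝕜 E F) : Prop :=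
  @IsCompact F 𝒯 (@closure F 𝒯 (T '' {x | ∀ i, x i ∈ Metric.ball (0 : E i) 1}))

/-- The same notion for linear maps (the case `n = 1`). -/
def LinearMap.IsCompactWrt {𝕜 : Type*} [NormedField 𝕜]
    {G : Type*} [NormedAddCommGroup G] [NormedSpace 𝕜 G]
    {F : Type*} [AddCommGroup F] [Module 𝕜 F]
    (𝒯 : TopologicalSpace F) (S : G →ₗ[𝕜] F) : Prop :=
  @IsCompact F 𝒯 (@closure F 𝒯 (S '' Metric.ball (0 : G) 1))

/-- The norm topology of `F`. -/
abbrev normTopology (F : Type*) [NormedAddCommGroup F] : TopologicalSpace F :=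
  inferInstance

/-- The weak topology `σ(F, F')` of a normed space, as a topology on `F` itself. -/
noncomputable abbrev weakTopology (𝕜 : Type*) [RCLike 𝕜] (F : Type*) [NormedAddCommGroup F] [NormedSpace 𝕜 F] :
    TopologicalSpace F :=
  TopologicalSpace.induced (toWeakSpace 𝕜 F) inferInstance

/-- `𝒦ⁿ(E₁, …, Eₙ; F)`: all compact `n`-linear maps. -/
def compactMultilinearMaps (𝕜 : Type*) [RCLike 𝕜] {n : ℕ} (E : Fin n → Type*)
    [∀ i, NormedAddCommGroup (E i)] [∀ i, NormedSpace 𝕜 (E i)]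
    (F : Type*) [NormedAddCommGroup F] [NormedSpace 𝕜 F] : Set (MultilinearMap 𝕜 E F) :=
  {T | T.IsCompactWrt (normTopology F)}

/-- `w𝒦ⁿ(E₁, …, Eₙ; F)`: all weakly compact `n`-linear maps. -/
def weaklyCompactMultilinearMaps (𝕜 : Type*) [RCLike 𝕜] {n : ℕ} (E : Fin n → Type*)
    [∀ i, NormedAddCommGroup (E i)] [∀ i, NormedSpace 𝕜 (E i)]
    (F : Type*) [NormedAddCommGroup F] [NormedSpace 𝕜 F] : Set (MultilinearMap 𝕜 E F) :=
  {T | T.IsCompactWrt (weakTopology 𝕜 F)}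

/-- `𝒦(G, F)`: all compact linear maps. -/
def compactLinearMaps (𝕜 : Type*) [RCLike 𝕜] (G : Type*) [NormedAddCommGroup G] [NormedSpace 𝕜 G]
    (F : Type*) [NormedAddCommGroup F] [NormedSpace 𝕜 F] : Set (G →ₗ[𝕜] F) :=
  {S | S.IsCompactWrt (normTopology F)}

/-- `w𝒦(G, F)`: all weakly compact linear maps. -/
def weaklyCompactLinearMaps (𝕜 : Type*) [RCLike 𝕜]
    (G : Type*) [NormedAddCommGroup G] [NormedSpace 𝕜 G]
    (F : Type*) [NormedAddCommGroup F] [NormedSpace 𝕜 F] : Set (G →ₗ[𝕜] F) :=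
  {S | S.IsCompactWrt (weakTopology 𝕜 F)}

/-- The completed projective tensor product `E₁ ⊗̂ ⋯ ⊗̂ Eₙ`: the completion of the algebraic tensor
product, which Mathlib equips with the projective norm
`‖z‖ = inf {∑ⱼ ∏ᵢ ‖xⱼᵢ‖ : z = ∑ⱼ xⱼ₁ ⊗ ⋯ ⊗ xⱼₙ}`. -/
abbrev CompletedProjTensor (𝕜 : Type*) [RCLike 𝕜] {n : ℕ} (E : Fin n → Type*)
    [∀ i, NormedAddCommGroup (E i)] [∀ i, NormedSpace 𝕜 (E i)] : Type _ :=
  UniformSpace.Completion (⨂[𝕜] i, E i)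

/-- The elementary tensor `x₁ ⊗̂ ⋯ ⊗̂ xₙ`. -/
noncomputable def completedTprod (𝕜 : Type*) [RCLike 𝕜] {n : ℕ} {E : Fin n → Type*}
    [∀ i, NormedAddCommGroup (E i)] [∀ i, NormedSpace 𝕜 (E i)] (x : ∀ i, E i) :
    CompletedProjTensor 𝕜 E :=
  ((PiTensorProduct.tprod 𝕜 x : ⨂[𝕜] i, E i) : UniformSpace.Completion (⨂[𝕜] i, E i))

/-! Linearization is an isometry from bounded multilinear maps onto bounded operators on the
completed projective tensor product (`completedLift`), so only compactness has to be matched. If a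
functional `f` is bounded by 1 on the image of the unit balls under `T`, then `f ∘ T`, hence also
its linearization, has norm at most 1. The linearized image of the unit ball therefore lies in the
bipolar of the multilinear image, that is, by Hahn-Banach, in its closed absolutely convex hull.
Such hulls preserve relative compactness (Mazur) and relative weak compactness (Krein). Conversely,
the multilinear image lies in a multiple of the linear one.

Boundedness of compact maps follows by homogeneity, and closedness from stability under uniform
approximation (Grothendieck's lemma in the weak case). `IsCompactnessClass` collects what is needed,
so both cases share one argument. Krein's theorem carries most of the work. -/

open Filter Topology Set MeasureTheory Pointwise

/-! ### Weak compactness: Grothendieck's lemma and Krein's theorem. -/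

section WeakCompactness

variable {𝕜 : Type*} [RCLike 𝕜] {F : Type*} [NormedAddCommGroup F] [NormedSpace 𝕜 F]

/-- **Helly's lemma**: a functional at positive distance from the span of finitely many functionals
takes the value `1` at a vector of controlled norm at which all of these vanish. -/
theorem exists_norm_le_and_eq_one_of_le_norm_sub {G : Type*} [NormedAddCommGroup G]
    [NormedSpace 𝕜 G] {ι : Type*} [Fintype ι] (φ : StrongDual 𝕜 G) (ψ : ι → StrongDual 𝕜 G) {d : ℝ}
    (hd : 0 < d) (hφ : ∀ c : ι → 𝕜, d ≤ ‖φ - ∑ i, c i • ψ i‖) :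
    ∃ g : G, ‖g‖ ≤ 2 / d ∧ φ g = 1 ∧ ∀ i, ψ i g = 0 := by
  let N : Submodule 𝕜 G := ⨅ i, LinearMap.ker (ψ i : G →ₗ[𝕜] 𝕜)
  have hN : ∀ g, g ∈ N ↔ ∀ i, ψ i g = 0 := by simp [N, Submodule.mem_iInf]
  -- If `χ` is a norm-preserving extension of `φ` restricted to `N`, then `φ - χ` vanishes on `N`,
  -- so it is a combination of the `ψ i`.
  have key : d ≤ ‖φ.comp N.subtypeL‖ := by
    obtain ⟨χ, hχ, hχn⟩ := exists_extension_norm_eq N (φ.comp N.subtypeL)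
    have hspan : ((φ - χ : StrongDual 𝕜 G) : G →ₗ[𝕜] 𝕜) ∈
        Submodule.span 𝕜 (range fun i ↦ (ψ i : G →ₗ[𝕜] 𝕜)) := by
      refine mem_span_of_iInf_ker_le_ker fun g hg ↦ ?_
      have := hχ ⟨g, hg⟩
      simp at this
      simp [this]
    obtain ⟨c, hc⟩ := (Submodule.mem_span_range_iff_exists_fun 𝕜).1 hspan
    have hχ' : φ - ∑ i, c i • ψ i = χ := by
      ext g
      have := LinearMap.congr_fun hc g
      simp at this ⊢
      rw [this]; ring
    rw [← hχn, ← hχ']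
    exact hφ c
  -- The norm on `N` need not be attained; giving up half of `d` produces the bound `2 / d`.
  obtain ⟨⟨g, hg⟩, hlt⟩ : ∃ g : N, d / 2 * ‖g‖ < ‖φ.comp N.subtypeL g‖ := by
    by_contra! h
    have := ContinuousLinearMap.opNorm_le_bound _ (by positivity) h
    linarith
  simp at hlt
  have h0 : φ g ≠ 0 := fun h ↦ by
    rw [h, norm_zero] at hlt
    have : 0 ≤ d / 2 * ‖g‖ := by positivity
    linarith
  refine ⟨(φ g)⁻¹ • g, ?_, by simp [h0], fun i ↦ by simp [(hN g).1 hg i]⟩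
  rw [norm_smul, norm_inv, inv_mul_le_iff₀ (by positivity), mul_div_assoc', le_div_iff₀ hd]
  linarith

/-- The range of an isometry defined on a complete space is closed. -/
theorem Isometry.mem_range_of_forall_exists_norm_sub_lt [CompleteSpace F] {G : Type*}
    [NormedAddCommGroup G] {f : F → G} (hf : Isometry f) {y : G}
    (h : ∀ d > 0, ∃ x, ‖y - f x‖ < d) : ∃ x, f x = y := by
  have hcl : IsClosed (range f) := hf.isClosedEmbedding.isClosed_range
  change y ∈ range f
  rw [← hcl.closure_eq, Metric.mem_closure_range_iff]
  intro d hd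
  obtain ⟨x, hx⟩ := h d hd
  exact ⟨x, by rwa [dist_eq_norm]⟩

/-- Every point of the convex hull of a subset of a weakly compact set is the barycenter of a
probability measure on it. -/
theorem exists_probabilityMeasure_of_mem_convexHull [NormedSpace ℝ F] [IsScalarTower ℝ 𝕜 F]
    {K : Set (WeakSpace 𝕜 F)} (hK : IsCompact K) [MeasurableSpace K] [BorelSpace K] {D : Set F}
    (hD : toWeakSpace 𝕜 F '' D ⊆ K) {x : F} (hx : x ∈ convexHull ℝ D) :
    ∃ ν : ProbabilityMeasure K, ∀ f : StrongDual 𝕜 F,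
      ∫ y : K, f ((toWeakSpace 𝕜 F).symm y) ∂(ν : Measure K) = f x := by
  have := isCompact_iff_compactSpace.1 hK
  suffices H : convexHull ℝ D ⊆ {x | ∃ ν : Measure K, IsProbabilityMeasure ν ∧
      ∀ f : StrongDual 𝕜 F, ∫ y : K, f ((toWeakSpace 𝕜 F).symm y) ∂ν = f x} by
    obtain ⟨ν, h, h'⟩ := H hx
    exact ⟨⟨ν, h⟩, h'⟩
  have hcont : ∀ f : StrongDual 𝕜 F, Continuous fun y : K ↦ f ((toWeakSpace 𝕜 F).symm y) :=
    fun f ↦ (WeakBilin.eval_continuous (topDualPairing 𝕜 F).flip f).comp continuous_subtype_val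
  -- Dirac measures represent points of `D`, and barycenters form a convex set.
  refine convexHull_min (fun x hx ↦ ?_) ?_
  · refine ⟨Measure.dirac ⟨toWeakSpace 𝕜 F x, hD ⟨x, hx, rfl⟩⟩, inferInstance, fun f ↦ ?_⟩
    rw [integral_dirac' _ _ (hcont f).stronglyMeasurable]
    simp
  · rintro x ⟨μ, hμ, hx⟩ y ⟨ν, hν, hy⟩ a b ha hb hab
    refine ⟨ENNReal.ofReal a • μ + ENNReal.ofReal b • ν, ⟨?_⟩, fun f ↦ ?_⟩
    · simp [← ENNReal.ofReal_add ha hb, hab]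
    · have hi : ∀ (ρ : Measure K) [IsProbabilityMeasure ρ],
          Integrable (fun y : K ↦ f ((toWeakSpace 𝕜 F).symm y)) ρ := fun ρ _ ↦
        (hcont f).integrable_of_hasCompactSupport (HasCompactSupport.of_compactSpace _)
      rw [integral_add_measure ((hi μ).smul_measure ENNReal.ofReal_ne_top)
        ((hi ν).smul_measure ENNReal.ofReal_ne_top), integral_smul_measure, integral_smul_measure,
        hx, hy, ENNReal.toReal_ofReal ha, ENNReal.toReal_ofReal hb, map_add,
        ← algebraMap_smul 𝕜 a x, ← algebraMap_smul 𝕜 b y, map_smul, map_smul, algebraMap_smul,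
        algebraMap_smul]

/-- A weakly bounded set is bounded. -/
theorem isBounded_of_isCompact_closure_toWeakSpace {A : Set F}
    (hA : IsCompact (closure (toWeakSpace 𝕜 F '' A))) : Bornology.IsBounded A := by
  have hb : ∀ f : StrongDual 𝕜 F, ∃ C, ∀ x : A,
      ‖NormedSpace.inclusionInDoubleDual 𝕜 F x f‖ ≤ C := by
    intro f
    obtain ⟨C, hC⟩ := hA.exists_bound_of_continuousOn
      (WeakBilin.eval_continuous (topDualPairing 𝕜 F).flip f).continuousOn
    exact ⟨C, fun x ↦ hC _ (subset_closure ⟨x, x.2, rfl⟩)⟩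
  obtain ⟨C, hC⟩ := banach_steinhaus hb
  refine isBounded_iff_forall_norm_le.2 ⟨C, fun x hx ↦ ?_⟩
  have := hC ⟨x, hx⟩
  rwa [← (NormedSpace.inclusionInDoubleDualLi (E := F) 𝕜).norm_map x]

/-- A bounded set is relatively weakly compact if every element of its weak-star closure in the bidual
is a norm limit of elements of the space. -/
theorem isCompact_closure_toWeakSpace_of_forall_exists_norm_sub_lt [CompleteSpace F] {A : Set F}
    (hb : Bornology.IsBounded A)
    (h : ∀ φ ∈ closure (NormedSpace.inclusionInDoubleDualWeak 𝕜 F '' (toWeakSpace 𝕜 F '' A)),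
      ∀ d > 0, ∃ x, ‖WeakDual.toStrongDual φ - NormedSpace.inclusionInDoubleDual 𝕜 F x‖ < d) :
    IsCompact (closure (toWeakSpace 𝕜 F '' A)) := by
  have hb' : Bornology.IsBounded (toWeakSpace 𝕜 F ⁻¹' (toWeakSpace 𝕜 F '' A)) := by
    rwa [preimage_image_eq _ (toWeakSpace 𝕜 F).injective]
  refine NormedSpace.isCompact_closure_of_isBounded 𝕜 F _ hb' fun φ hφ ↦ ?_
  have hφ' : ∀ d > 0, ∃ x, ‖WeakDual.toStrongDual φ -
      NormedSpace.inclusionInDoubleDualLi (E := F) 𝕜 x‖ < d := h φ hφ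
  obtain ⟨x, hx⟩ : ∃ x, NormedSpace.inclusionInDoubleDualLi (E := F) 𝕜 x =
      WeakDual.toStrongDual φ := Isometry.mem_range_of_forall_exists_norm_sub_lt
    (NormedSpace.inclusionInDoubleDualLi (E := F) 𝕜).isometry hφ'
  refine ⟨toWeakSpace 𝕜 F x, DFunLike.ext _ _ fun f ↦ ?_⟩
  exact DFunLike.congr_fun hx f

/-- **Grothendieck's lemma**: a set that is approximated uniformly by relatively weakly compact sets
is relatively weakly compact. -/
theorem isCompact_closure_toWeakSpace_of_subset_add_closedBall [CompleteSpace F] {A : Set F}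
    (h : ∀ ε > 0, ∃ B : Set F, IsCompact (closure (toWeakSpace 𝕜 F '' B)) ∧
      A ⊆ B + Metric.closedBall 0 ε) :
    IsCompact (closure (toWeakSpace 𝕜 F '' A)) := by
  refine isCompact_closure_toWeakSpace_of_forall_exists_norm_sub_lt ?_ fun φ hφ d hd ↦ ?_
  · obtain ⟨B, hB, hAB⟩ := h 1 one_pos
    exact ((isBounded_of_isCompact_closure_toWeakSpace hB).add Metric.isBounded_closedBall).subset
      hAB
  · obtain ⟨B, hB, hAB⟩ := h (d / 2) (by positivity)
    let ι := NormedSpace.inclusionInDoubleDualWeak 𝕜 F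
    let U : Set (WeakDual 𝕜 (StrongDual 𝕜 F)) := {ψ | ‖WeakDual.toStrongDual ψ‖ ≤ d / 2}
    have hU : IsCompact U := by
      convert WeakDual.isCompact_closedBall (0 : StrongDual 𝕜 (StrongDual 𝕜 F)) (d / 2) using 1
      ext ψ
      exact (mem_closedBall_zero_iff (E := StrongDual 𝕜 (StrongDual 𝕜 F))).symm
    -- By Banach-Alaoglu `U` is weak-star compact, so this sum is compact and captures the whole
    -- weak-star closure of the image of `A`.
    have hclosed : IsClosed (ι '' closure (toWeakSpace 𝕜 F '' B) + U) :=
      ((hB.image ι.continuous).add hU).isClosed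
    have hsub : ι '' (toWeakSpace 𝕜 F '' A) ⊆ ι '' closure (toWeakSpace 𝕜 F '' B) + U := by
      rintro _ ⟨_, ⟨x, hx, rfl⟩, rfl⟩
      obtain ⟨b, hb, u, hu, rfl⟩ := hAB hx
      refine ⟨ι (toWeakSpace 𝕜 F b), ⟨_, subset_closure ⟨b, hb, rfl⟩, rfl⟩,
        ι (toWeakSpace 𝕜 F u), ?_, by simp⟩
      exact (NormedSpace.double_dual_bound 𝕜 F u).trans (mem_closedBall_zero_iff.1 hu)
    obtain ⟨_, ⟨b, -, rfl⟩, u, hu, rfl⟩ := closure_minimal hsub hclosed hφ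
    obtain ⟨b, rfl⟩ := (toWeakSpace 𝕜 F).surjective b
    refine ⟨b, ?_⟩
    have : WeakDual.toStrongDual (ι (toWeakSpace 𝕜 F b) + u) -
        NormedSpace.inclusionInDoubleDual 𝕜 F b =
        WeakDual.toStrongDual u := by
      ext f
      simp only [ι, map_add, sub_apply, add_apply]
      exact add_sub_cancel_left (f b) (u f)
    change ‖WeakDual.toStrongDual (ι (toWeakSpace 𝕜 F b) + u) - _‖ < d
    rw [this]
    exact lt_of_le_of_lt hu (by linarith)

/-- A bounded sequence of functionals that tends to zero pointwise on a set tends to zero pointwise on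
its weak closure. -/
theorem tendsto_zero_of_mem_closure_toWeakSpace [NormedSpace ℝ F] [IsScalarTower ℝ 𝕜 F]
    {f : ℕ → StrongDual 𝕜 F} {M : ℝ} (hM : ∀ n, ‖f n‖ ≤ M) {D : Set F}
    (hD : ∀ x ∈ D, Tendsto (fun n ↦ f n x) atTop (𝓝 0)) {y : WeakSpace 𝕜 F}
    (hy : y ∈ closure (toWeakSpace 𝕜 F '' D)) :
    Tendsto (fun n ↦ f n ((toWeakSpace 𝕜 F).symm y)) atTop (𝓝 0) := by
  let Z : Set F := {x | Tendsto (fun n ↦ f n x) atTop (𝓝 0)}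
  have hconv : Convex ℝ Z := by
    intro x hx y hy a b _ _ _
    have := (hx.const_smul a).add (hy.const_smul b)
    simp only [smul_zero, add_zero] at this
    refine this.congr fun n ↦ ?_
    rw [map_add, ← algebraMap_smul 𝕜 a x, ← algebraMap_smul 𝕜 b y, map_smul, map_smul,
      algebraMap_smul, algebraMap_smul]
  have hclosed : closure Z ⊆ Z := by
    intro x hx
    have hM0 : 0 ≤ M := (norm_nonneg _).trans (hM 0)
    refine Metric.tendsto_atTop.2 fun ε hε ↦ ?_
    obtain ⟨z, hz, hxz⟩ := Metric.mem_closure_iff.1 hx (ε / (2 * (M + 1))) (by positivity)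
    obtain ⟨N, hN⟩ := Metric.tendsto_atTop.1 hz (ε / 2) (by positivity)
    refine ⟨N, fun n hn ↦ ?_⟩
    have h1 := hN n hn
    rw [dist_zero_right] at h1 ⊢
    rw [dist_eq_norm, lt_div_iff₀ (by positivity)] at hxz
    have h2 : ‖f n (x - z)‖ ≤ M * ‖x - z‖ := (f n).le_of_opNorm_le (hM n) _
    have h3 : f n x = f n (x - z) + f n z := by simp
    have h4 := norm_add_le (f n (x - z)) (f n z)
    rw [← h3] at h4
    nlinarith [norm_nonneg (x - z)]
  have hy' := closure_mono (image_mono hD) hy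
  change y ∈ closure (toWeakSpace 𝕜 F '' Z) at hy'
  -- `Z` is convex, so its weak and norm closures agree (Mazur).
  rw [← hconv.toWeakSpace_closure 𝕜] at hy'
  obtain ⟨x, hx, rfl⟩ := hy'
  simpa using! hclosed hx

/-- **Krein's theorem**: the convex hull of a relatively weakly compact subset of a Banach space is
relatively weakly compact. -/
theorem isCompact_closure_toWeakSpace_convexHull [CompleteSpace F] [NormedSpace ℝ F]
    [IsScalarTower ℝ 𝕜 F] {A : Set F} (hA : IsCompact (closure (toWeakSpace 𝕜 F '' A))) :
    IsCompact (closure (toWeakSpace 𝕜 F '' convexHull ℝ A)) := by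
  refine isCompact_closure_toWeakSpace_of_forall_exists_norm_sub_lt
    (isBounded_convexHull.2 (isBounded_of_isCompact_closure_toWeakSpace hA)) fun φ hφ d hd ↦ ?_
  by_contra! hdist
  -- Each stage is a functional, a finite subset of `A` and a point of its hull. By Helly the new
  -- functional kills the earlier finite sets. As `φ` takes the value 1 at all functionals chosen so
  -- far, a single point of the hull of `A` makes them all close to 1.
  obtain ⟨g, hg, hgr⟩ := exists_seq_of_forall_finset_exists
    (P := fun p : StrongDual 𝕜 F × Finset F × F ↦ ‖p.1‖ ≤ 2 / d ∧
      WeakDual.toStrongDual φ p.1 = 1 ∧ ↑p.2.1 ⊆ A ∧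
      p.2.2 ∈ convexHull ℝ (p.2.1 : Set F) ∧ ‖p.1 p.2.2 - 1‖ < 1 / 2)
    (r := fun p q ↦ (∀ x ∈ p.2.1, q.1 x = 0) ∧ ‖p.1 q.2.2 - 1‖ < 1 / 2) (by
      classical
      intro s hs
      obtain ⟨f, hfn, hf1, hf0⟩ := exists_norm_le_and_eq_one_of_le_norm_sub
        (WeakDual.toStrongDual φ) (fun x : s.biUnion (fun p ↦ p.2.1) ↦
          NormedSpace.inclusionInDoubleDual 𝕜 F x) hd (fun c ↦ by
            simpa using hdist (∑ x, c x • (x : F)))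
      let T : Finset (StrongDual 𝕜 F) := insert f (s.image Prod.fst)
      have hT : ∀ h ∈ T, WeakDual.toStrongDual φ h = 1 := by
        intro h hh
        rcases Finset.mem_insert.1 hh with rfl | hh
        · exact hf1
        · obtain ⟨p, hp, rfl⟩ := Finset.mem_image.1 hh
          exact (hs p hp).2.1
      have hopen : IsOpen (⋂ h ∈ T, {ψ : WeakDual 𝕜 (StrongDual 𝕜 F) | ‖ψ h - 1‖ < 1 / 2}) :=
        isOpen_biInter_finset fun h _ ↦ isOpen_lt
          ((WeakDual.eval_continuous h).sub continuous_const).norm continuous_const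
      obtain ⟨_, hψ, _, ⟨x, hx, rfl⟩, rfl⟩ := mem_closure_iff.1 hφ _ hopen (by
        simp only [mem_iInter]
        intro h hh
        have : φ h = 1 := hT h hh
        simp [this])
      simp only [mem_iInter] at hψ
      rw [convexHull_eq_union_convexHull_finite_subsets] at hx
      simp only [mem_iUnion] at hx
      obtain ⟨S, hS, hxS⟩ := hx
      refine ⟨(f, S, x), ⟨hfn, hf1, hS, hxS, hψ f (Finset.mem_insert_self _ _)⟩, fun p hp ↦
        ⟨fun y hy ↦ hf0 ⟨y, Finset.mem_biUnion.2 ⟨p, hp, hy⟩⟩,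
          hψ p.1 (Finset.mem_insert_of_mem (Finset.mem_image_of_mem _ hp))⟩⟩)
  let D : Set F := ⋃ n, ((g n).2.1 : Set F)
  have hDA : D ⊆ A := iUnion_subset fun n ↦ (hg n).2.2.1
  let K : Set (WeakSpace 𝕜 F) := closure (toWeakSpace 𝕜 F '' D)
  have hK : IsCompact K := hA.of_isClosed_subset isClosed_closure
    (closure_mono (image_mono hDA))
  have := isCompact_iff_compactSpace.1 hK
  let : MeasurableSpace K := borel K
  have : BorelSpace K := ⟨rfl⟩
  have hcont : ∀ f : StrongDual 𝕜 F, Continuous fun y : K ↦ f ((toWeakSpace 𝕜 F).symm y) :=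
    fun f ↦ (WeakBilin.eval_continuous (topDualPairing 𝕜 F).flip f).comp continuous_subtype_val
  have hν : ∀ n, ∃ ν : ProbabilityMeasure K, ∀ f : StrongDual 𝕜 F,
      ∫ y : K, f ((toWeakSpace 𝕜 F).symm y) ∂(ν : Measure K) = f (g n).2.2 := fun n ↦
    exists_probabilityMeasure_of_mem_convexHull hK subset_closure
      (convexHull_mono (subset_iUnion (fun n ↦ ((g n).2.1 : Set F)) n) (hg n).2.2.2.1)
  choose ν hν using hν
  -- Probability measures on the compact `K` form a compact space; an ultrafilter limit avoids any
  -- need for metrizability.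
  obtain ⟨μ, -, hμ⟩ := isCompact_univ.ultrafilter_le_nhds ((hyperfilter ℕ).map ν) (by simp)
  have hμ' : Tendsto ν (hyperfilter ℕ : Filter ℕ) (𝓝 μ) := hμ
  rw [ProbabilityMeasure.tendsto_iff_forall_integral_rclike_tendsto 𝕜] at hμ'
  have hhyp : (hyperfilter ℕ : Filter ℕ) ≤ atTop := by
    rw [← Nat.cofinite_eq_atTop]; exact hyperfilter_le_cofinite
  have hge : ∀ m, ‖∫ y : K, (g m).1 ((toWeakSpace 𝕜 F).symm y) ∂(μ : Measure K) - 1‖ ≤ 1 / 2 := by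
    intro m
    have := hμ' (BoundedContinuousFunction.mkOfCompact ⟨_, hcont (g m).1⟩)
    simp only [BoundedContinuousFunction.mkOfCompact_apply, ContinuousMap.coe_mk, hν] at this
    refine le_of_tendsto (this.sub_const 1).norm (hhyp ?_)
    filter_upwards [eventually_gt_atTop m] with n hn using (hgr m n hn).2.le
  -- The functionals are eventually zero at each point of `D`, hence tend to zero on `K`. Dominated
  -- convergence then contradicts `hge`.
  have hlim : Tendsto (fun m ↦ ∫ y : K, (g m).1 ((toWeakSpace 𝕜 F).symm y) ∂(μ : Measure K))
      atTop (𝓝 (∫ _ : K, (0 : 𝕜) ∂(μ : Measure K))) := by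
    obtain ⟨C, hC⟩ := (isBounded_of_isCompact_closure_toWeakSpace hA).exists_norm_le
    have hd' : 0 ≤ 2 / d := by positivity
    have hbound : ∀ f : StrongDual 𝕜 F, ‖f‖ ≤ 2 / d → ∀ y : K,
        ‖f ((toWeakSpace 𝕜 F).symm y)‖ ≤ 2 / d * C := by
      intro f hf y
      have hcl : IsClosed {z : WeakSpace 𝕜 F | ‖f ((toWeakSpace 𝕜 F).symm z)‖ ≤ 2 / d * C} :=
        isClosed_le (WeakBilin.eval_continuous (topDualPairing 𝕜 F).flip f).norm continuous_const
      refine closure_minimal ?_ hcl y.2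
      rintro _ ⟨x, hx, rfl⟩
      exact f.le_of_opNorm_le_of_le hf (hC x (hDA hx))
    refine tendsto_integral_of_dominated_convergence (fun _ ↦ 2 / d * C)
      (fun n ↦ (hcont _).aestronglyMeasurable) (integrable_const _)
      (fun n ↦ Eventually.of_forall (hbound _ (hg n).1)) (Eventually.of_forall fun y ↦ ?_)
    refine tendsto_zero_of_mem_closure_toWeakSpace (fun n ↦ (hg n).1) (fun x hx ↦ ?_) y.2
    obtain ⟨m, hm⟩ := mem_iUnion.1 hx
    refine tendsto_const_nhds.congr' ?_
    filter_upwards [eventually_gt_atTop m] with n hn using ((hgr m n hn).1 x hm).symm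
  rw [integral_zero] at hlim
  have := le_of_tendsto' (hlim.sub_const 1).norm hge
  norm_num at this

end WeakCompactness

/-! ### Axioms for compactness classes and the two instances. -/

section CompactnessClass

/-- The set of points of `F` at which every functional bounded by `1` on `A` is bounded by `1`. -/
def absBipolar (𝕜 : Type*) [RCLike 𝕜] {F : Type*} [NormedAddCommGroup F] [NormedSpace 𝕜 F]
    (A : Set F) : Set F :=
  {y | ∀ f : StrongDual 𝕜 F, (∀ a ∈ A, ‖f a‖ ≤ 1) → ‖f y‖ ≤ 1}

/-- The properties shared by the relatively compact and the relatively weakly compact subsets of a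
Banach space: they form a vector bornology of bounded sets that is stable under uniform approximation
and under closed absolutely convex hulls. -/
structure IsCompactnessClass (𝕜 : Type*) [RCLike 𝕜] {F : Type*} [NormedAddCommGroup F]
    [NormedSpace 𝕜 F] (P : Set F → Prop) : Prop where
  mono : ∀ {A B : Set F}, A ⊆ B → P B → P A
  isBounded : ∀ {A : Set F}, P A → Bornology.IsBounded A
  singleton : ∀ x : F, P {x}
  add : ∀ {A B : Set F}, P A → P B → P (A + B)
  smul : ∀ (c : 𝕜) {A : Set F}, P A → P (c • A)
  of_approx : ∀ {A : Set F}, (∀ ε > 0, ∃ B, P B ∧ A ⊆ B + Metric.closedBall 0 ε) → P A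
  absBipolar : ∀ {A : Set F}, A.Nonempty → P A → P (absBipolar 𝕜 A)

variable {𝕜 : Type*} [RCLike 𝕜] {F : Type*} [NormedAddCommGroup F] [NormedSpace 𝕜 F]

/-- **Bipolar theorem**: a point of the absolute bipolar of a set lies in its closed absolutely
convex hull. -/
theorem absBipolar_subset_closure_convexHull [NormedSpace ℝ F] [IsScalarTower ℝ 𝕜 F] {A : Set F}
    (hA : A.Nonempty) :
    absBipolar 𝕜 A ⊆ closure (convexHull ℝ (Metric.closedBall (0 : 𝕜) 1 • A)) := by
  intro y hy
  by_contra hy'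
  obtain ⟨f, u, hu, huy⟩ := RCLike.geometric_hahn_banach_closed_point (𝕜 := 𝕜)
    (convex_convexHull ℝ (Metric.closedBall (0 : 𝕜) 1 • A)).closure isClosed_closure hy'
  have hsub : ∀ c : 𝕜, ‖c‖ ≤ 1 → ∀ a ∈ A, RCLike.re (f (c • a)) < u := fun c hc a ha ↦
    hu _ (subset_closure (subset_convexHull ℝ _ (smul_mem_smul (by simpa using hc) ha)))
  -- Nonemptiness matters: the bipolar always contains 0, while the hull of the empty set is empty.
  have hu0 : 0 < u := by
    obtain ⟨a, ha⟩ := hA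
    simpa using hsub 0 (by simp) a ha
  have hfa : ∀ a ∈ A, ‖((u : 𝕜)⁻¹ • f) a‖ ≤ 1 := by
    intro a ha
    -- The phase `c` rotates `f a` onto its modulus, turning a bound on real parts into a bound on
    -- norms.
    obtain ⟨c, hc, hca⟩ := RCLike.exists_norm_eq_mul_self (f a)
    have := hsub c hc.le a ha
    rw [map_smul, smul_eq_mul, ← hca, RCLike.ofReal_re] at this
    rw [smul_apply, norm_smul, norm_inv, RCLike.norm_ofReal, abs_of_pos hu0,
      inv_mul_le_iff₀ hu0, mul_one]
    exact this.le
  have := hy _ hfa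
  rw [smul_apply, norm_smul, norm_inv, RCLike.norm_ofReal, abs_of_pos hu0,
    inv_mul_le_iff₀ hu0, mul_one] at this
  exact absurd (huy.trans_le (RCLike.re_le_norm _)) (not_lt.2 this)

theorem isCompact_closure_image_of_subset {X Y : Type*} [TopologicalSpace X] [TopologicalSpace Y]
    [T2Space Y] {K : Set X} (hK : IsCompact K) {g : X → Y} (hg : Continuous g) {A : Set Y}
    (hA : A ⊆ g '' K) : IsCompact (closure A) :=
  (hK.image hg).of_isClosed_subset isClosed_closure
    (closure_minimal hA (hK.image hg).isClosed)

variable (𝕜 F)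

/-- Approximation and hulls are handled through total boundedness, which in a complete space means
relative compactness. -/
theorem isCompactnessClass_isCompact_closure [CompleteSpace F] :
    IsCompactnessClass 𝕜 fun A : Set F ↦ IsCompact (closure A) where
  mono h hB := hB.of_isClosed_subset isClosed_closure (closure_mono h)
  isBounded h := h.isBounded.subset subset_closure
  singleton x := by simp
  add hA hB := isCompact_closure_image_of_subset (hA.prod hB) continuous_add (by
    rintro _ ⟨a, ha, b, hb, rfl⟩
    exact ⟨(a, b), ⟨subset_closure ha, subset_closure hb⟩, rfl⟩)
  smul c _ hA := isCompact_closure_image_of_subset hA (continuous_const_smul c)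
    (image_mono subset_closure)
  of_approx {A} h := by
    refine TotallyBounded.isCompact_of_isClosed (Metric.totallyBounded_iff.2 fun ε hε ↦ ?_).closure
      isClosed_closure
    obtain ⟨B, hB, hAB⟩ := h (ε / 2) (by positivity)
    obtain ⟨t, ht, hBt⟩ := Metric.totallyBounded_iff.1 (hB.totallyBounded.subset subset_closure)
      (ε / 2) (by positivity)
    refine ⟨t, ht, fun x hx ↦ ?_⟩
    obtain ⟨b, hb, v, hv, rfl⟩ := hAB hx
    obtain ⟨z, hz, hbz⟩ := mem_iUnion₂.1 (hBt hb)
    refine mem_iUnion₂.2 ⟨z, hz, ?_⟩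
    rw [mem_closedBall_zero_iff] at hv
    rw [Metric.mem_ball, dist_eq_norm] at hbz ⊢
    calc ‖b + v - z‖ = ‖(b - z) + v‖ := by congr 1; abel
      _ ≤ ‖b - z‖ + ‖v‖ := norm_add_le _ _
      _ < ε := by linarith
  absBipolar {A} hne hA := by
    let := NormedSpace.restrictScalars ℝ 𝕜 F
    have : IsScalarTower ℝ 𝕜 F := IsScalarTower.of_algebraMap_smul fun _ _ ↦ rfl
    have h1 : IsCompact (closure (Metric.closedBall (0 : 𝕜) 1 • A)) :=
      isCompact_closure_image_of_subset ((isCompact_closedBall (0 : 𝕜) 1).prod hA) continuous_smul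
        (by
          rintro _ ⟨c, hc, a, ha, rfl⟩
          exact ⟨(c, a), ⟨hc, subset_closure ha⟩, rfl⟩)
    have h2 : IsCompact (closure (convexHull ℝ (Metric.closedBall (0 : 𝕜) 1 • A))) :=
      TotallyBounded.isCompact_of_isClosed
        (TotallyBounded.convexHull (h1.totallyBounded.subset subset_closure)).closure
        isClosed_closure
    exact h2.of_isClosed_subset isClosed_closure
      (closure_minimal (absBipolar_subset_closure_convexHull hne) isClosed_closure)

/-- Here approximation is Grothendieck's lemma and the hull is Krein's theorem. -/
theorem isCompactnessClass_isCompact_closure_toWeakSpace [CompleteSpace F] :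
    IsCompactnessClass 𝕜 fun A : Set F ↦ IsCompact (closure (toWeakSpace 𝕜 F '' A)) where
  mono h hB := hB.of_isClosed_subset isClosed_closure (closure_mono (image_mono h))
  isBounded h := isBounded_of_isCompact_closure_toWeakSpace h
  singleton x := by simp
  add hA hB := isCompact_closure_image_of_subset (hA.prod hB) continuous_add (by
    rintro _ ⟨_, ⟨a, ha, b, hb, rfl⟩, rfl⟩
    exact ⟨(toWeakSpace 𝕜 F a, toWeakSpace 𝕜 F b),
      ⟨subset_closure ⟨a, ha, rfl⟩, subset_closure ⟨b, hb, rfl⟩⟩, by simp⟩)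
  smul c _ hA := isCompact_closure_image_of_subset hA (continuous_const_smul c) (by
    rintro _ ⟨_, ⟨a, ha, rfl⟩, rfl⟩
    exact ⟨toWeakSpace 𝕜 F a, subset_closure ⟨a, ha, rfl⟩, by simp⟩)
  of_approx h := isCompact_closure_toWeakSpace_of_subset_add_closedBall h
  absBipolar {A} hne hA := by
    let := NormedSpace.restrictScalars ℝ 𝕜 F
    have : IsScalarTower ℝ 𝕜 F := IsScalarTower.of_algebraMap_smul fun _ _ ↦ rfl
    have h1 : IsCompact (closure (toWeakSpace 𝕜 F '' (Metric.closedBall (0 : 𝕜) 1 • A))) :=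
      isCompact_closure_image_of_subset ((isCompact_closedBall (0 : 𝕜) 1).prod hA) continuous_smul
        (by
          rintro _ ⟨_, ⟨c, hc, a, ha, rfl⟩, rfl⟩
          exact ⟨(c, toWeakSpace 𝕜 F a), ⟨hc, subset_closure ⟨a, ha, rfl⟩⟩, by simp⟩)
    refine (isCompact_closure_toWeakSpace_convexHull h1).of_isClosed_subset isClosed_closure
      (closure_minimal ?_ isClosed_closure)
    rw [← (convex_convexHull ℝ _).toWeakSpace_closure 𝕜]
    exact image_mono (absBipolar_subset_closure_convexHull hne)

end CompactnessClass

/-! ### Automatic boundedness by homogeneity. -/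

section

variable {𝕜 : Type*} [RCLike 𝕜] {F : Type*} [NormedAddCommGroup F] [NormedSpace 𝕜 F]

/-- A multilinear map that is bounded on the product of the open unit balls is bounded. -/
theorem MultilinearMap.norm_le_mul_prod_of_forall_norm_lt_one {n : ℕ} {E : Fin n → Type*}
    [∀ i, NormedAddCommGroup (E i)] [∀ i, NormedSpace 𝕜 (E i)] (T : MultilinearMap 𝕜 E F) {C : ℝ}
    (hC : ∀ x : ∀ i, E i, (∀ i, ‖x i‖ < 1) → ‖T x‖ ≤ C) (x : ∀ i, E i) :
    ‖T x‖ ≤ C * ∏ i, ‖x i‖ := by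
  by_cases h0 : ∃ i, x i = 0
  · obtain ⟨i, hi⟩ := h0
    rw [T.map_coord_zero i hi, Finset.prod_eq_zero (Finset.mem_univ i) (by simp [hi])]
    simp
  push Not at h0
  -- The balls are open, so dividing `x i` by its norm is not enough; the extra factor `t` tends to
  -- 1 at the end.
  have key : ∀ t : ℝ, 1 < t → ‖T x‖ ≤ C * ∏ i, (t * ‖x i‖) := by
    intro t ht
    have hpos : ∀ i, 0 < t * ‖x i‖ := fun i ↦
      mul_pos (by linarith) (norm_pos_iff.2 (h0 i))
    have hx : x = fun i ↦ ((t * ‖x i‖ : ℝ) : 𝕜) • (((t * ‖x i‖ : ℝ) : 𝕜)⁻¹ • x i) := by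
      funext i
      rw [smul_inv_smul₀]
      exact_mod_cast (hpos i).ne'
    have hlt := hC (fun i ↦ ((t * ‖x i‖ : ℝ) : 𝕜)⁻¹ • x i) fun i ↦ by
      rw [norm_smul, norm_inv, RCLike.norm_ofReal, abs_of_pos (hpos i), inv_mul_lt_iff₀ (hpos i)]
      nlinarith [norm_pos_iff.2 (h0 i)]
    conv_lhs => rw [hx]
    rw [T.map_smul_univ, norm_smul, norm_prod, mul_comm]
    simp only [RCLike.norm_ofReal, abs_of_pos (hpos _)]
    exact mul_le_mul_of_nonneg_right hlt (Finset.prod_nonneg fun i _ ↦ (hpos i).le)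
  have hlim : Tendsto (fun t : ℝ ↦ C * ∏ i, (t * ‖x i‖)) (𝓝[>] 1) (𝓝 (C * ∏ i, (1 * ‖x i‖))) :=
    (Continuous.tendsto (by fun_prop) 1).mono_left nhdsWithin_le_nhds
  simp only [one_mul] at hlim
  exact ge_of_tendsto hlim (by filter_upwards [self_mem_nhdsWithin] with t ht using key t ht)

/-- A linear map that is bounded on the open unit ball is bounded. -/
theorem LinearMap.norm_le_mul_of_forall_norm_lt_one {G : Type*} [NormedAddCommGroup G]
    [NormedSpace 𝕜 G] (S : G →ₗ[𝕜] F) {C : ℝ} (hC : ∀ x : G, ‖x‖ < 1 → ‖S x‖ ≤ C) (x : G) :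
    ‖S x‖ ≤ C * ‖x‖ := by
  let T : MultilinearMap 𝕜 (fun _ : Fin 1 ↦ G) F := LinearMap.compMultilinearMap S
    (MultilinearMap.ofSubsingleton 𝕜 G G 0 LinearMap.id)
  simpa [T] using T.norm_le_mul_prod_of_forall_norm_lt_one (C := C)
    (fun x hx ↦ by simpa [T] using hC _ (hx 0)) fun _ ↦ x

end

/-! ### Linearization on the completed projective tensor product. -/

section CompletedTensor

/-- Bounded linear maps into a Banach space extend isometrically to the completion. -/
noncomputable def completionExtend (𝕜 : Type*) [RCLike 𝕜] (X : Type*) [SeminormedAddCommGroup X]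
    [NormedSpace 𝕜 X] (F : Type*) [NormedAddCommGroup F] [NormedSpace 𝕜 F] [CompleteSpace F] :
    (X →L[𝕜] F) ≃ₗᵢ[𝕜] (UniformSpace.Completion X →L[𝕜] F) :=
  LinearIsometryEquiv.symm
    { toFun := fun S ↦ S.comp UniformSpace.Completion.toComplL
      map_add' := fun _ _ ↦ rfl
      map_smul' := fun _ _ ↦ rfl
      invFun := fun T ↦ T.extend (UniformSpace.Completion.toComplL : X →L[𝕜] UniformSpace.Completion X)
      left_inv := fun S ↦ ContinuousLinearMap.extend_unique _ UniformSpace.Completion.denseRange_coe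
        (UniformSpace.Completion.isUniformInducing_coe _) S rfl
      right_inv := fun T ↦ ContinuousLinearMap.ext fun x ↦
        T.extend_eq (e := UniformSpace.Completion.toComplL) UniformSpace.Completion.denseRange_coe
          (UniformSpace.Completion.isUniformInducing_coe _) x
      norm_map' := fun S ↦ by
        refine le_antisymm ?_ ?_
        · refine ContinuousLinearMap.opNorm_le_bound _ (norm_nonneg S) fun z ↦ ?_
          simpa using! S.le_opNorm (z : UniformSpace.Completion X)
        · refine ContinuousLinearMap.opNorm_le_bound _ (norm_nonneg _) fun z ↦ ?_
          -- The bound is a closed condition, so checking it on the dense image of `X` suffices.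
          induction z using UniformSpace.Completion.induction_on with
          | hp => exact isClosed_le (by fun_prop) (by fun_prop)
          | ih z => simpa using! (S.comp UniformSpace.Completion.toComplL).le_opNorm z }

theorem completionExtend_coe {𝕜 : Type*} [RCLike 𝕜] {X : Type*} [SeminormedAddCommGroup X]
    [NormedSpace 𝕜 X] {F : Type*} [NormedAddCommGroup F] [NormedSpace 𝕜 F] [CompleteSpace F]
    (T : X →L[𝕜] F) (x : X) : completionExtend 𝕜 X F T x = T x :=
  T.extend_eq (e := UniformSpace.Completion.toComplL) UniformSpace.Completion.denseRange_coe
    (UniformSpace.Completion.isUniformInducing_coe _) x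

variable (𝕜 : Type*) [RCLike 𝕜] {n : ℕ} (E : Fin n → Type*) [∀ i, NormedAddCommGroup (E i)]
  [∀ i, NormedSpace 𝕜 (E i)] (F : Type*) [NormedAddCommGroup F] [NormedSpace 𝕜 F]

/-- The universal property of the completed projective tensor product: bounded multilinear maps are
the same as bounded linear maps on it, isometrically. -/
noncomputable def completedLift [CompleteSpace F] :
    ContinuousMultilinearMap 𝕜 E F ≃ₗᵢ[𝕜] (CompletedProjTensor 𝕜 E →L[𝕜] F) :=
  (PiTensorProduct.liftIsometry 𝕜 E F).trans (completionExtend 𝕜 _ F)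

variable {E F}

theorem completedLift_completedTprod [CompleteSpace F] (T : ContinuousMultilinearMap 𝕜 E F)
    (x : ∀ i, E i) : completedLift 𝕜 E F T (completedTprod 𝕜 x) = T x := by
  refine (completionExtend_coe _ _).trans ?_
  simp

theorem completedLift_symm_apply [CompleteSpace F] (S : CompletedProjTensor 𝕜 E →L[𝕜] F)
    (x : ∀ i, E i) : (completedLift 𝕜 E F).symm S x = S (completedTprod 𝕜 x) := by
  rw [← completedLift_completedTprod, LinearIsometryEquiv.apply_symm_apply]

theorem norm_completedTprod_le (x : ∀ i, E i) : ‖completedTprod 𝕜 x‖ ≤ ∏ i, ‖x i‖ := by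
  rw [completedTprod, UniformSpace.Completion.norm_coe]
  exact PiTensorProduct.projectiveSeminorm_tprod_le x

/-- Naturality in the target: the scalar-valued isometry then controls the norm of `f` composed with
the linearization. -/
theorem completedLift_comp [CompleteSpace F] (f : StrongDual 𝕜 F)
    (T : ContinuousMultilinearMap 𝕜 E F) :
    completedLift 𝕜 E 𝕜 (f.compContinuousMultilinearMap T) = f.comp (completedLift 𝕜 E F T) := by
  rw [← LinearIsometryEquiv.eq_symm_apply]
  ext x
  rw [completedLift_symm_apply]
  simp [completedLift_completedTprod]

variable {𝕜}

/-- The image of the unit ball under the linearization of `T` lies in the bipolar of the image of the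
product of the unit balls under `T`. -/
theorem completedLift_image_ball_subset [CompleteSpace F] (T : ContinuousMultilinearMap 𝕜 E F) :
    completedLift 𝕜 E F T '' Metric.ball 0 1 ⊆
      absBipolar 𝕜 (T '' {x | ∀ i, x i ∈ Metric.ball (0 : E i) 1}) := by
  rintro _ ⟨z, hz, rfl⟩ f hf
  have h1 : ‖f.compContinuousMultilinearMap T‖ ≤ 1 := by
    refine ContinuousMultilinearMap.opNorm_le_bound zero_le_one fun x ↦ ?_
    exact (f.compContinuousMultilinearMap
      T).toMultilinearMap.norm_le_mul_prod_of_forall_norm_lt_one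
      (fun x hx ↦ hf _ ⟨x, by simpa using hx, rfl⟩) x
  rw [← (completedLift 𝕜 E 𝕜).norm_map, completedLift_comp] at h1
  exact ((f.comp (completedLift 𝕜 E F T)).unit_le_opNorm z (mem_ball_zero_iff.1 hz).le).trans h1

/-- Elementary tensors of vectors in the unit balls lie in twice the unit ball. -/
theorem completedLift_symm_image_subset [CompleteSpace F]
    (S : CompletedProjTensor 𝕜 E →L[𝕜] F) :
    (completedLift 𝕜 E F).symm S '' {x | ∀ i, x i ∈ Metric.ball (0 : E i) 1} ⊆
      (2 : 𝕜) • (S '' Metric.ball 0 1) := by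
  rintro _ ⟨x, hx, rfl⟩
  -- For `n = 0` the product of norms is 1, so only the closed ball is guaranteed; halving enters
  -- the open ball.
  refine ⟨S ((2 : 𝕜)⁻¹ • completedTprod 𝕜 x), ⟨_, ?_, rfl⟩, ?_⟩
  · have h1 : ‖completedTprod 𝕜 x‖ ≤ 1 := (norm_completedTprod_le 𝕜 x).trans
      (Finset.prod_le_one (fun _ _ ↦ norm_nonneg _) fun i _ ↦ (mem_ball_zero_iff.1 (hx i)).le)
    rw [mem_ball_zero_iff, norm_smul, norm_inv, RCLike.norm_two]
    linarith
  · simp [completedLift_symm_apply]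

/-- The bounded multilinear maps sending the product of the unit balls to a set of a given
compactness class. -/
def IsCompactnessClass.submodule {P : Set F → Prop} (hP : IsCompactnessClass 𝕜 P)
    (E : Fin n → Type*) [∀ i, NormedAddCommGroup (E i)] [∀ i, NormedSpace 𝕜 (E i)] :
    Submodule 𝕜 (ContinuousMultilinearMap 𝕜 E F) where
  carrier := {T | P (T '' {x | ∀ i, x i ∈ Metric.ball (0 : E i) 1})}
  zero_mem' := hP.mono (by rintro _ ⟨x, -, rfl⟩; rfl) (hP.singleton 0)
  add_mem' hT hT' := hP.mono (by
    rintro _ ⟨x, hx, rfl⟩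
    exact ⟨_, ⟨x, hx, rfl⟩, _, ⟨x, hx, rfl⟩, rfl⟩) (hP.add hT hT')
  smul_mem' c _ hT := hP.mono (by
    rintro _ ⟨x, hx, rfl⟩
    exact ⟨_, ⟨x, hx, rfl⟩, rfl⟩) (hP.smul c hT)

/-- On the product of the unit balls, maps close in norm are uniformly close, so `of_approx`
applies. -/
theorem IsCompactnessClass.isClosed_submodule {P : Set F → Prop} (hP : IsCompactnessClass 𝕜 P) :
    IsClosed (hP.submodule E : Set (ContinuousMultilinearMap 𝕜 E F)) := by
  refine isClosed_of_closure_subset fun T hT ↦ hP.of_approx fun ε hε ↦ ?_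
  obtain ⟨T', hT', hd⟩ := Metric.mem_closure_iff.1 hT ε hε
  refine ⟨_, hT', ?_⟩
  rintro _ ⟨x, hx, rfl⟩
  refine ⟨T' x, ⟨x, hx, rfl⟩, (T - T') x, ?_, by simp⟩
  rw [dist_eq_norm] at hd
  rw [mem_closedBall_zero_iff]
  calc ‖(T - T') x‖ ≤ ‖T - T'‖ * ∏ i, ‖x i‖ := (T - T').le_opNorm x
    _ ≤ ‖T - T'‖ * 1 := by
      gcongr
      exact Finset.prod_le_one (fun _ _ ↦ norm_nonneg _) fun i _ ↦ (mem_ball_zero_iff.1 (hx i)).le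
    _ ≤ ε := by linarith

/-- Continuity is not lost or assumed: sets of the class are bounded, which makes the map bounded.
-/
theorem IsCompactnessClass.image_toMultilinearMap_submodule {P : Set F → Prop}
    (hP : IsCompactnessClass 𝕜 P) :
    ContinuousMultilinearMap.toMultilinearMap ''
        (hP.submodule E : Set (ContinuousMultilinearMap 𝕜 E F)) =
      {T : MultilinearMap 𝕜 E F | P (T '' {x | ∀ i, x i ∈ Metric.ball (0 : E i) 1})} := by
  ext T
  constructor
  · rintro ⟨T, hT, rfl⟩
    exact hT
  · intro hT
    obtain ⟨C, hC⟩ := (hP.isBounded hT).exists_norm_le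
    exact ⟨T.mkContinuous C (T.norm_le_mul_prod_of_forall_norm_lt_one fun x hx ↦
      hC _ ⟨x, by simpa using hx, rfl⟩), hT, rfl⟩

theorem IsCompactnessClass.image_toLinearMap_map_submodule [CompleteSpace F] {P : Set F → Prop}
    (hP : IsCompactnessClass 𝕜 P) :
    ContinuousLinearMap.toLinearMap '' (((hP.submodule E).map
        (completedLift 𝕜 E F).toLinearEquiv.toLinearMap :
          Submodule 𝕜 (CompletedProjTensor 𝕜 E →L[𝕜] F)) : Set (CompletedProjTensor 𝕜 E →L[𝕜] F)) =
      {S : CompletedProjTensor 𝕜 E →ₗ[𝕜] F | P (S '' Metric.ball 0 1)} := by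
  ext S
  constructor
  · rintro ⟨_, ⟨T, hT, rfl⟩, rfl⟩
    exact hP.mono (completedLift_image_ball_subset T) (hP.absBipolar ⟨_, 0, by simp, rfl⟩ hT)
  · intro hS
    obtain ⟨C, hC⟩ := (hP.isBounded hS).exists_norm_le
    let S' := S.mkContinuous C (S.norm_le_mul_of_forall_norm_lt_one fun x hx ↦
      hC _ ⟨x, by simpa using hx, rfl⟩)
    exact ⟨S', ⟨(completedLift 𝕜 E F).symm S',
      hP.mono (completedLift_symm_image_subset S') (hP.smul 2 hS),
      (completedLift 𝕜 E F).apply_symm_apply S'⟩, rfl⟩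

/-- Multilinear maps and their linearizations define isometric spaces for every compactness class. -/
theorem IsCompactnessClass.exists_submodule_linearIsometryEquiv [CompleteSpace F]
    {P : Set F → Prop} (hP : IsCompactnessClass 𝕜 P) (E : Fin n → Type*)
    [∀ i, NormedAddCommGroup (E i)] [∀ i, NormedSpace 𝕜 (E i)] :
    ∃ (K : Submodule 𝕜 (ContinuousMultilinearMap 𝕜 E F))
        (L : Submodule 𝕜 (CompletedProjTensor 𝕜 E →L[𝕜] F)),
      ContinuousMultilinearMap.toMultilinearMap '' (K : Set (ContinuousMultilinearMap 𝕜 E F)) =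
          {T : MultilinearMap 𝕜 E F | P (T '' {x | ∀ i, x i ∈ Metric.ball (0 : E i) 1})} ∧
      ContinuousLinearMap.toLinearMap '' (L : Set (CompletedProjTensor 𝕜 E →L[𝕜] F)) =
          {S : CompletedProjTensor 𝕜 E →ₗ[𝕜] F | P (S '' Metric.ball 0 1)} ∧
      IsClosed (K : Set (ContinuousMultilinearMap 𝕜 E F)) ∧
      ∃ Φ : K ≃ₗᵢ[𝕜] L, ∀ (T : K) (x : ∀ i, E i),
        (Φ T : CompletedProjTensor 𝕜 E →L[𝕜] F) (completedTprod 𝕜 x) =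
          (T : ContinuousMultilinearMap 𝕜 E F) x :=
  ⟨hP.submodule E, _, hP.image_toMultilinearMap_submodule, hP.image_toLinearMap_map_submodule,
    hP.isClosed_submodule,
    { (completedLift 𝕜 E F).toLinearEquiv.submoduleMap (hP.submodule E) with
      norm_map' := fun T ↦ (completedLift 𝕜 E F).norm_map T },
    fun T x ↦ completedLift_completedTprod 𝕜 (T : ContinuousMultilinearMap 𝕜 E F) x⟩

end CompletedTensor

/-! ### Transfer to the weak topology on `F` itself, and conclusion. -/

theorem isCompact_closure_induced_iff {X Y : Type*} [t : TopologicalSpace Y] {e : X → Y}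
    (he : Function.Surjective e) {A : Set X} :
    @IsCompact X (t.induced e) (@closure X (t.induced e) A) ↔ IsCompact (closure (e '' A)) := by
  let := t.induced e
  have hind : IsInducing e := ⟨rfl⟩
  rw [hind.isCompact_iff, hind.closure_eq_preimage_closure_image, image_preimage_eq _ he]

theorem isCompact_closure_weakTopology_iff {𝕜 : Type*} [RCLike 𝕜] {F : Type*}
    [NormedAddCommGroup F] [NormedSpace 𝕜 F] {A : Set F} :
    @IsCompact F (weakTopology 𝕜 F) (@closure F (weakTopology 𝕜 F) A) ↔
      IsCompact (closure (toWeakSpace 𝕜 F '' A)) :=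
  isCompact_closure_induced_iff (toWeakSpace 𝕜 F).surjective

theorem mainTheorem5 {𝕜 : Type*} [RCLike 𝕜] {n : ℕ} (E : Fin n → Type*)
    [∀ i, NormedAddCommGroup (E i)] [∀ i, NormedSpace 𝕜 (E i)] [∀ i, CompleteSpace (E i)]
    (F : Type*) [NormedAddCommGroup F] [NormedSpace 𝕜 F] [CompleteSpace F] :
    (∃ (K : Submodule 𝕜 (ContinuousMultilinearMap 𝕜 E F))
        (L : Submodule 𝕜 (CompletedProjTensor 𝕜 E →L[𝕜] F)),
      ContinuousMultilinearMap.toMultilinearMap '' (K : Set (ContinuousMultilinearMap 𝕜 E F)) =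
          compactMultilinearMaps 𝕜 E F ∧
      ContinuousLinearMap.toLinearMap '' (L : Set (CompletedProjTensor 𝕜 E →L[𝕜] F)) =
          compactLinearMaps 𝕜 (CompletedProjTensor 𝕜 E) F ∧
      IsClosed (K : Set (ContinuousMultilinearMap 𝕜 E F)) ∧
      ∃ Φ : K ≃ₗᵢ[𝕜] L, ∀ (T : K) (x : ∀ i, E i),
        (Φ T : CompletedProjTensor 𝕜 E →L[𝕜] F) (completedTprod 𝕜 x) =
          (T : ContinuousMultilinearMap 𝕜 E F) x) ∧
    (∃ (K : Submodule 𝕜 (ContinuousMultilinearMap 𝕜 E F))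
        (L : Submodule 𝕜 (CompletedProjTensor 𝕜 E →L[𝕜] F)),
      ContinuousMultilinearMap.toMultilinearMap '' (K : Set (ContinuousMultilinearMap 𝕜 E F)) =
          weaklyCompactMultilinearMaps 𝕜 E F ∧
      ContinuousLinearMap.toLinearMap '' (L : Set (CompletedProjTensor 𝕜 E →L[𝕜] F)) =
          weaklyCompactLinearMaps 𝕜 (CompletedProjTensor 𝕜 E) F ∧
      IsClosed (K : Set (ContinuousMultilinearMap 𝕜 E F)) ∧
      ∃ Φ : K ≃ₗᵢ[𝕜] L, ∀ (T : K) (x : ∀ i, E i),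
        (Φ T : CompletedProjTensor 𝕜 E →L[𝕜] F) (completedTprod 𝕜 x) =
          (T : ContinuousMultilinearMap 𝕜 E F) x) := by
  -- The norm case matches by unfolding; the weak one first needs the passage from `WeakSpace` to
  -- the induced topology.
  refine ⟨(isCompactnessClass_isCompact_closure 𝕜 F).exists_submodule_linearIsometryEquiv E, ?_⟩
  have h : IsCompactnessClass 𝕜 fun A : Set F ↦
      @IsCompact F (weakTopology 𝕜 F) (@closure F (weakTopology 𝕜 F) A) := by
    simpa only [isCompact_closure_weakTopology_iff] using
      isCompactnessClass_isCompact_closure_toWeakSpace 𝕜 F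
  exact h.exists_submodule_linearIsometryEquiv E
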